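/- Let $\mathcal{A}$ be the disc algebra, i.e. the complex Banach algebra, under the supremum norm, of all continuous functions $f:\{z\in\mathbb{C}:|z|\le 1\}\to\mathbb{C}$ that are holomorphic on $\{|z|<1\}$. Then every element of $\mathrm{SL}_2(\mathcal{A})$ is a product of two exponentials: for every $2\times 2$ matrix $M$ over $\mathcal{A}$ with $\det M=1$ there are $2\times 2$ matrices $X,Y$ over $\mathcal{A}$ with $\operatorname{tr}X=\operatorname{tr}Y=0$ such that $$M=\exp(X)\exp(Y),$$ where $\exp(X)=\sum_{n\ge 0}X^n/n!$ is the matrix exponential over $\mathcal{A}$. -/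

import Mathlib

/-- The disc algebra: continuous functions on the closed unit disc in `ℂ` that are holomorphic on
the open unit disc, as a subalgebra of `C(closed disc, ℂ)`. In particular it carries the supremum
norm and the topology of uniform convergence. The value `0` of the extension outside the closed
disc plays no role, since the open disc is an open subset of the closed disc. -/
def discAlgebra : Subalgebra ℂ C(Metric.closedBall (0 : ℂ) 1, ℂ) where
  carrier := {f | DifferentiableOn ℂ (Function.extend Subtype.val f 0) (Metric.ball (0 : ℂ) 1)}
  mul_mem' := by
    intro f g hf hg
    refine (DifferentiableOn.mul hf hg).congr fun z hz => ?_
    have h (k : Metric.closedBall (0 : ℂ) 1 → ℂ) : Function.extend Subtype.val k 0 z =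
        k ⟨z, Metric.ball_subset_closedBall hz⟩ :=
      Subtype.val_injective.extend_apply k 0 ⟨z, Metric.ball_subset_closedBall hz⟩
    simp [h]
  add_mem' := by
    intro f g hf hg
    refine (DifferentiableOn.add hf hg).congr fun z hz => ?_
    have h (k : Metric.closedBall (0 : ℂ) 1 → ℂ) : Function.extend Subtype.val k 0 z =
        k ⟨z, Metric.ball_subset_closedBall hz⟩ :=
      Subtype.val_injective.extend_apply k 0 ⟨z, Metric.ball_subset_closedBall hz⟩
    simp [h]
  algebraMap_mem' := by
    intro c
    refine (differentiableOn_const c).congr fun z hz => ?_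
    have h (k : Metric.closedBall (0 : ℂ) 1 → ℂ) : Function.extend Subtype.val k 0 z =
        k ⟨z, Metric.ball_subset_closedBall hz⟩ :=
      Subtype.val_injective.extend_apply k 0 ⟨z, Metric.ball_subset_closedBall hz⟩
    simp [h]

/-! Since `det M = 1`, the first column `(a, c)` of `M` is unimodular. The analytic core,
`expReducible_of_bezout`, is stable rank one in a strong form: `a + α * c = exp h` for some `α`,
`h`. Conjugation by an elementary matrix makes the upper left entry `exp h`, so the conjugate is a
lower times an upper triangular matrix. Splitting `h = g + k` with `k` a large constant makes `exp g
- exp (-g)` and `exp k - exp (-k)` units. Both factors are then diagonalizable by unipotent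
matrices, hence exponentials of trace-zero matrices.

For the core, if `u * f + v * g = 1`, then `f' = f * (1 + (f' - f) * u) + (f' - f) * v * g`, so a
small change of `f` only multiplies it by an exponential modulo `g`. By density `f` may be a
polynomial, hence a product of factors `z - w`. If `|w| > 1`, the factor is an exponential times
nothing else; if `|w| = 1`, `w` is pushed outside. If `|w| < 1`, `w` moves in the disc off the zeros
of `g`, a connected set, to a point near the circle from which it can jump outside. -/

namespace discAlgebra

open Metric

/-- The extension by `0` of an element of the disc algebra is holomorphic on the open disc and
continuous up to the boundary. -/
theorem diffContOnCl (f : discAlgebra) :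
    DiffContOnCl ℂ (Function.extend Subtype.val (f : C(closedBall (0 : ℂ) 1, ℂ)) 0)
      (ball (0 : ℂ) 1) := by
  refine ⟨f.2, ?_⟩
  rw [closure_ball _ one_ne_zero, continuousOn_iff_continuous_domRestrict]
  refine f.1.continuous.congr fun z => ?_
  rw [Set.domRestrict_apply, Subtype.val_injective.extend_apply]

theorem extend_apply (f : discAlgebra) (z : closedBall (0 : ℂ) 1) :
    Function.extend Subtype.val (f : C(closedBall (0 : ℂ) 1, ℂ)) 0 (z : ℂ) = f.1 z :=
  Subtype.val_injective.extend_apply _ _ _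

/-- The element of the disc algebra given by a function on `ℂ` that is holomorphic on the open
disc and continuous up to the boundary. -/
def ofDiffContOnCl (F : ℂ → ℂ) (hF : DiffContOnCl ℂ F (ball (0 : ℂ) 1)) : discAlgebra :=
  ⟨⟨fun z => F z, hF.continuousOn_ball.domRestrict⟩, hF.1.congr fun z hz =>
    Subtype.val_injective.extend_apply (fun z : closedBall (0 : ℂ) 1 => F z) 0
      ⟨z, ball_subset_closedBall hz⟩⟩

@[simp]
theorem ofDiffContOnCl_apply (F : ℂ → ℂ) (hF : DiffContOnCl ℂ F (ball (0 : ℂ) 1))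
    (z : closedBall (0 : ℂ) 1) : (ofDiffContOnCl F hF).1 z = F z := rfl

theorem ext_apply {f g : discAlgebra} (h : ∀ z, f.1 z = g.1 z) : f = g :=
  Subtype.ext (ContinuousMap.ext h)

/-- Locally uniform limits of holomorphic functions are holomorphic. Completeness follows, which the
exponential series needs. -/
theorem isClosed_coe : IsClosed (discAlgebra : Set C(closedBall (0 : ℂ) 1, ℂ)) := by
  refine isClosed_of_closure_subset fun f hf => ?_
  obtain ⟨u, hu, hlim⟩ := mem_closure_iff_seq_limit.1 hf
  refine TendstoLocallyUniformlyOn.differentiableOn (φ := Filter.atTop)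
    (F := fun n => Function.extend Subtype.val (u n) 0) ?_ (Filter.Eventually.of_forall hu)
    isOpen_ball
  refine TendstoUniformlyOn.tendstoLocallyUniformlyOn ?_
  rw [ContinuousMap.tendsto_iff_tendstoUniformly] at hlim
  rw [Metric.tendstoUniformlyOn_iff]
  rw [Metric.tendstoUniformly_iff] at hlim
  intro ε hε
  filter_upwards [hlim ε hε] with n hn z hz
  have := hn ⟨z, ball_subset_closedBall hz⟩
  rwa [← Subtype.val_injective.extend_apply f 0, ← Subtype.val_injective.extend_apply (u n) 0]
    at this

instance : CompleteSpace discAlgebra := isClosed_coe.completeSpace_coe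

noncomputable instance : NormedAlgebra ℚ discAlgebra :=
  NormedAlgebra.restrictScalars ℚ ℂ discAlgebra

/-- Evaluation at a point of the closed disc. -/
noncomputable def evalHom (z : closedBall (0 : ℂ) 1) : discAlgebra →ₐ[ℂ] ℂ :=
  (ContinuousMap.evalAlgHom ℂ ℂ z).comp discAlgebra.val

theorem evalHom_apply (z : closedBall (0 : ℂ) 1) (f : discAlgebra) : evalHom z f = f.1 z := rfl

theorem norm_apply_le (f : discAlgebra) (z : closedBall (0 : ℂ) 1) : ‖f.1 z‖ ≤ ‖f‖ :=
  f.1.norm_coe_le_norm z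

theorem norm_le_of_forall {f : discAlgebra} {C : ℝ} (hC : 0 ≤ C) (h : ∀ z, ‖f.1 z‖ ≤ C) :
    ‖f‖ ≤ C :=
  (ContinuousMap.norm_le f.1 hC).2 h

/-- The maximum principle: the norm is controlled by the values on the unit circle. -/
theorem norm_le_of_forall_sphere {f : discAlgebra} {C : ℝ} (hC : 0 ≤ C)
    (h : ∀ z : closedBall (0 : ℂ) 1, ‖(z : ℂ)‖ = 1 → ‖f.1 z‖ ≤ C) : ‖f‖ ≤ C := by
  refine norm_le_of_forall hC fun z => ?_
  rw [← extend_apply]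
  refine Complex.norm_le_of_forall_mem_frontier_norm_le isBounded_ball (diffContOnCl f) ?_ ?_
  · intro w hw
    rw [frontier_ball _ one_ne_zero, mem_sphere_zero_iff_norm] at hw
    exact (extend_apply f ⟨w, by simp [hw]⟩).symm ▸ h ⟨w, by simp [hw]⟩ hw
  · rw [closure_ball _ one_ne_zero]
    exact z.2

theorem exp_apply (f : discAlgebra) (z : closedBall (0 : ℂ) 1) :
    (NormedSpace.exp f).1 z = Complex.exp (f.1 z) := by
  have hc : Continuous (evalHom z) :=
    (continuous_eval_const z).comp continuous_subtype_val
  rw [← evalHom_apply, NormedSpace.map_exp (evalHom z) hc, evalHom_apply, Complex.exp_eq_exp_ℂ]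

theorem exists_exp_eq_one_add {x : discAlgebra} (hx : ‖x‖ < 1) :
    ∃ h : discAlgebra, NormedSpace.exp h = 1 + x := by
  have hF := diffContOnCl x
  have hs : ∀ z ∈ closedBall (0 : ℂ) 1,
      1 + Function.extend Subtype.val x.1 0 z ∈ Complex.slitPlane := by
    intro z hz
    rw [extend_apply x ⟨z, hz⟩]
    exact Complex.mem_slitPlane_of_norm_lt_one ((norm_apply_le x _).trans_lt hx)
  have hd : DiffContOnCl ℂ (fun z => Complex.log (1 + Function.extend Subtype.val x.1 0 z))
      (ball (0 : ℂ) 1) := by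
    refine ⟨(hF.1.const_add 1).clog fun z hz => hs z (ball_subset_closedBall hz), ?_⟩
    rw [closure_ball _ one_ne_zero]
    exact (continuousOn_const.add hF.continuousOn_ball).clog hs
  refine ⟨ofDiffContOnCl _ hd, ext_apply fun z => ?_⟩
  rw [exp_apply, ofDiffContOnCl_apply, Complex.exp_log (Complex.slitPlane_ne_zero (hs z z.2)),
    extend_apply]
  rfl

theorem exists_exp_eq_algebraMap {c : ℂ} (hc : c ≠ 0) :
    ∃ h : discAlgebra, NormedSpace.exp h = algebraMap ℂ discAlgebra c := by
  refine ⟨algebraMap ℂ discAlgebra (Complex.log c), ext_apply fun z => ?_⟩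
  rw [exp_apply]
  exact Complex.exp_log hc

/-- The coordinate function. -/
def coord : discAlgebra := ofDiffContOnCl id differentiable_id.diffContOnCl

@[simp]
theorem coord_apply (z : closedBall (0 : ℂ) 1) : coord.1 z = z := rfl

theorem norm_coord_le : ‖coord‖ ≤ 1 :=
  norm_le_of_forall zero_le_one fun z => mem_closedBall_zero_iff.1 z.2

theorem isUnit_of_forall_ne_zero {f : discAlgebra} (h : ∀ z, f.1 z ≠ 0) : IsUnit f := by
  have h' : ∀ z ∈ closure (ball (0 : ℂ) 1), Function.extend Subtype.val f.1 0 z ≠ 0 := by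
    intro z hz
    rw [closure_ball _ one_ne_zero] at hz
    exact (extend_apply f ⟨z, hz⟩).symm ▸ h _
  refine IsUnit.of_mul_eq_one (ofDiffContOnCl _ ((diffContOnCl f).inv h')) (ext_apply fun z => ?_)
  have : f.1 z * (ofDiffContOnCl _ ((diffContOnCl f).inv h')).1 z = 1 := by
    rw [ofDiffContOnCl_apply, Pi.inv_apply, extend_apply, mul_inv_cancel₀ (h z)]
  exact this

/-- The difference quotient of `g` at a point of the open disc. -/
theorem exists_sub_eq_mul (g : discAlgebra) {w : closedBall (0 : ℂ) 1} (hw : ‖(w : ℂ)‖ < 1) :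
    ∃ q : discAlgebra, (coord - algebraMap ℂ _ (w : ℂ)) * q = g - algebraMap ℂ _ (g.1 w) := by
  have hw' : (w : ℂ) ∈ ball (0 : ℂ) 1 := by simpa using hw
  have hG := diffContOnCl g
  have hd : DiffContOnCl ℂ (dslope (Function.extend Subtype.val g.1 0) w) (ball (0 : ℂ) 1) := by
    refine ⟨(Complex.differentiableOn_dslope (isOpen_ball.mem_nhds hw')).2 hG.1, ?_⟩
    rw [closure_ball _ one_ne_zero]
    exact (continuousOn_dslope (Filter.mem_of_superset (isOpen_ball.mem_nhds hw')
      ball_subset_closedBall)).2 ⟨hG.continuousOn_ball, hG.differentiableAt isOpen_ball hw'⟩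
  refine ⟨ofDiffContOnCl _ hd, ext_apply fun z => ?_⟩
  have := sub_smul_dslope (Function.extend Subtype.val g.1 0) (w : ℂ) (z : ℂ)
  rw [extend_apply, extend_apply] at this
  exact this

/-- Polynomials are dense in the disc algebra. -/
theorem exists_polynomial_norm_sub_lt (f : discAlgebra) {ε : ℝ} (hε : 0 < ε) :
    ∃ p : Polynomial ℂ, ‖Polynomial.aeval coord p - f‖ < ε := by
  have hF := diffContOnCl f
  set F := Function.extend Subtype.val f.1 0 with hFdef
  have huc := (isCompact_closedBall (0 : ℂ) 1).uniformContinuousOn_of_continuous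
    hF.continuousOn_ball
  obtain ⟨δ, hδ, hδF⟩ := Metric.uniformContinuousOn_iff.1 huc (ε / 4) (by positivity)
  obtain ⟨r, hr0, hr1, hrδ⟩ : ∃ r : ℝ, 0 < r ∧ r < 1 ∧ 1 - r < δ := by
    refine ⟨1 - min δ 1 / 2, ?_, ?_, ?_⟩ <;>
      rcases min_cases δ 1 with ⟨h, _⟩ | ⟨h, _⟩ <;> rw [h] <;> linarith
  have hps := hF.hasFPowerSeriesOnBall (R := 1) one_pos
  obtain ⟨r', hrr', hr'1⟩ := exists_between hr1
  lift r' to NNReal using (hr0.trans hrr').le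
  have hu := Metric.tendstoUniformlyOn_iff.1
    (hps.tendstoUniformlyOn (r' := r') (by exact_mod_cast hr'1)) (ε / 4) (by positivity)
  obtain ⟨n, hn⟩ := hu.exists
  -- A Taylor partial sum of the dilate `z ↦ f (r z)`, which is uniformly close to `f`.
  refine ⟨∑ k ∈ Finset.range n, Polynomial.C ((cauchyPowerSeries F 0 1).coeff k * (r : ℂ) ^ k) *
    Polynomial.X ^ k, ?_⟩
  refine (norm_le_of_forall (C := ε / 2) (by positivity) fun z => ?_).trans_lt (by linarith)
  have hz : ‖(z : ℂ)‖ ≤ 1 := mem_closedBall_zero_iff.1 z.2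
  have hrz : ‖(r : ℂ) * z‖ ≤ r := by
    rw [norm_mul, Complex.norm_real, Real.norm_of_nonneg hr0.le]
    nlinarith
  have h1 := hn ((r : ℂ) * z) (by simpa using hrz.trans_lt hrr')
  have h2 := hδF ((r : ℂ) * z) (by simpa using hrz.trans hr1.le) z z.2 (by
    rw [dist_eq_norm, show (r : ℂ) * z - z = ((r - 1 : ℝ) : ℂ) * z by push_cast; ring, norm_mul,
      Complex.norm_real, Real.norm_eq_abs, abs_sub_comm, abs_of_pos (by linarith)]
    nlinarith)
  have h3 : (Polynomial.aeval coord (∑ k ∈ Finset.range n,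
      Polynomial.C ((cauchyPowerSeries F 0 1).coeff k * (r : ℂ) ^ k) * Polynomial.X ^ k)
        - f).1 z = (cauchyPowerSeries F 0 1).partialSum n ((r : ℂ) * z) - F z := by
    rw [← evalHom_apply, map_sub, ← Polynomial.aeval_algHom_apply, evalHom_apply, evalHom_apply,
      hFdef, extend_apply]
    congr 1
    simp only [coord_apply, map_sum, map_mul, Polynomial.aeval_C, map_pow, Polynomial.aeval_X,
      FormalMultilinearSeries.partialSum, FormalMultilinearSeries.apply_eq_pow_smul_coeff]
    refine Finset.sum_congr rfl fun k _ => ?_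
    simp only [Algebra.algebraMap_self, RingHom.id_apply, smul_eq_mul]
    ring
  rw [h3, ← dist_eq_norm]
  refine (dist_triangle _ (F ((r : ℂ) * z)) _).trans ?_
  rw [zero_add, dist_comm, NNReal.coe_one] at h1
  linarith

/-! ### Reducibility to an exponential -/

/-- `f` agrees modulo `g` with an exponential. -/
def ExpReducible (f g : discAlgebra) : Prop :=
  ∃ h α : discAlgebra, f + α * g = NormedSpace.exp h

theorem ExpReducible.mul {f₁ f₂ g : discAlgebra} (h₁ : ExpReducible f₁ g)
    (h₂ : ExpReducible f₂ g) : ExpReducible (f₁ * f₂) g := by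
  obtain ⟨a, α, ha⟩ := h₁
  obtain ⟨b, β, hb⟩ := h₂
  refine ⟨a + b, f₁ * β + α * f₂ + α * β * g, ?_⟩
  rw [NormedSpace.exp_add, ← ha, ← hb]
  ring

theorem expReducible_exp (h g : discAlgebra) : ExpReducible (NormedSpace.exp h) g :=
  ⟨h, 0, by simp⟩

theorem exp_mul_exp_neg (h : discAlgebra) : NormedSpace.exp h * NormedSpace.exp (-h) = 1 := by
  rw [← NormedSpace.exp_add, add_neg_cancel, NormedSpace.exp_zero]

/-- For a unimodular pair, reducibility is stable under small perturbations of the first entry. -/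
theorem expReducible_iff_of_norm_lt {f f' g u v : discAlgebra} (huv : u * f + v * g = 1)
    (hlt : ‖(f' - f) * u‖ < 1) : ExpReducible f g ↔ ExpReducible f' g := by
  obtain ⟨k, hk⟩ := exists_exp_eq_one_add hlt
  have hf' : f' = f * NormedSpace.exp k + (f' - f) * v * g := by
    rw [hk]
    linear_combination (f - f') * huv
  constructor
  · rintro ⟨h, α, hα⟩
    refine ⟨h + k, α * NormedSpace.exp k - (f' - f) * v, ?_⟩
    rw [NormedSpace.exp_add]
    linear_combination hf' + NormedSpace.exp k * hα
  · rintro ⟨h, α, hα⟩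
    refine ⟨h + -k, (α + (f' - f) * v) * NormedSpace.exp (-k), ?_⟩
    rw [NormedSpace.exp_add]
    linear_combination NormedSpace.exp (-k) * hα - NormedSpace.exp (-k) * hf' -
      f * exp_mul_exp_neg k

/-- Keeps the pair unimodular when `f` is replaced by a polynomial. -/
theorem exists_bezout_of_norm_lt {f f' g u v : discAlgebra} (huv : u * f + v * g = 1)
    (hlt : ‖(f' - f) * u‖ < 1) : ∃ u' v' : discAlgebra, u' * f' + v' * g = 1 := by
  obtain ⟨k, hk⟩ := exists_exp_eq_one_add hlt
  refine ⟨u * NormedSpace.exp (-k), v - u * NormedSpace.exp (-k) * (f' - f) * v, ?_⟩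
  linear_combination huv + u * f * exp_mul_exp_neg k - u * f * NormedSpace.exp (-k) * hk -
    u * NormedSpace.exp (-k) * (f' - f) * huv

/-! ### Linear factors -/

theorem expReducible_coord_sub_of_one_lt {w : ℂ} (hw : 1 < ‖w‖) (g : discAlgebra) :
    ExpReducible (coord - algebraMap ℂ _ w) g := by
  have hw0 : w ≠ 0 := norm_pos_iff.1 (one_pos.trans hw)
  have hlt : ‖(-w⁻¹) • coord‖ < 1 := by
    rw [norm_smul, norm_neg, norm_inv]
    exact (mul_le_of_le_one_right (by positivity) norm_coord_le).trans_lt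
      (inv_lt_one_of_one_lt₀ hw)
  obtain ⟨h, hh⟩ := exists_exp_eq_one_add hlt
  obtain ⟨k, hk⟩ := exists_exp_eq_algebraMap (neg_ne_zero.2 hw0)
  -- `z - w = -w (1 - z / w)`, and both factors have logarithms.
  have : coord - algebraMap ℂ _ w = NormedSpace.exp (k + h) := by
    rw [NormedSpace.exp_add, hh, hk, mul_add, mul_one, ← Algebra.smul_def, smul_smul,
      neg_mul_neg, mul_inv_cancel₀ hw0, one_smul, map_neg]
    ring
  exact this ▸ expReducible_exp _ _

theorem sub_coord_sub (w w' : ℂ) :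
    (coord - algebraMap ℂ discAlgebra w') - (coord - algebraMap ℂ discAlgebra w) =
      algebraMap ℂ discAlgebra (w - w') := by
  rw [map_sub]
  ring

theorem expReducible_coord_sub_of_norm_eq_one {w : ℂ} (hw : ‖w‖ = 1) {g u v : discAlgebra}
    (huv : u * (coord - algebraMap ℂ _ w) + v * g = 1) :
    ExpReducible (coord - algebraMap ℂ _ w) g := by
  set t : ℝ := (‖u‖ + 1)⁻¹ with ht
  have ht0 : 0 < t := by positivity
  refine (expReducible_iff_of_norm_lt (f' := coord - algebraMap ℂ _ ((1 + t : ℝ) * w)) huv ?_).2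
    (expReducible_coord_sub_of_one_lt ?_ g)
  · rw [sub_coord_sub, ← Algebra.smul_def, norm_smul,
      show w - ((1 + t : ℝ) : ℂ) * w = -((t : ℂ) * w) by push_cast; ring, norm_neg, norm_mul, hw,
      Complex.norm_real, Real.norm_of_nonneg ht0.le, mul_one, ht, inv_mul_lt_iff₀ (by positivity)]
    linarith
  · rw [norm_mul, hw, Complex.norm_real, Real.norm_of_nonneg (by positivity)]
    linarith

/-- The Bézout identity for `z - w` and `g` at a point `w` of the open disc with `g w ≠ 0`. -/
theorem exists_bezout_coord_sub {g : discAlgebra} {w : closedBall (0 : ℂ) 1}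
    (hw : ‖(w : ℂ)‖ < 1) (hg : g.1 w ≠ 0) :
    ∃ u v : discAlgebra, u * (coord - algebraMap ℂ _ (w : ℂ)) + v * g = 1 := by
  obtain ⟨q, hq⟩ := exists_sub_eq_mul g hw
  have hone : algebraMap ℂ discAlgebra (g.1 w)⁻¹ * algebraMap ℂ discAlgebra (g.1 w) = 1 := by
    rw [← map_mul, inv_mul_cancel₀ hg, map_one]
  refine ⟨-(algebraMap ℂ _ (g.1 w)⁻¹) * q, algebraMap ℂ _ (g.1 w)⁻¹, ?_⟩
  linear_combination hone - algebraMap ℂ discAlgebra (g.1 w)⁻¹ * hq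

theorem exists_sphere_apply_ne_zero {g : discAlgebra} (hg : g ≠ 0) :
    ∃ p : closedBall (0 : ℂ) 1, ‖(p : ℂ)‖ = 1 ∧ g.1 p ≠ 0 := by
  by_contra! h
  exact hg (norm_le_zero_iff.1 (norm_le_of_forall_sphere le_rfl fun z hz => by simp [h z hz]))

/-- Near a boundary point at which `g` does not vanish there are points `w` of the open disc for
which `z - w` is reducible modulo `g`. -/
theorem exists_expReducible_coord_sub {g : discAlgebra} (hg : g ≠ 0) :
    ∃ w : closedBall (0 : ℂ) 1, ‖(w : ℂ)‖ < 1 ∧ g.1 w ≠ 0 ∧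
      ExpReducible (coord - algebraMap ℂ _ (w : ℂ)) g := by
  obtain ⟨p, hp, hgp⟩ := exists_sphere_apply_ne_zero hg
  set m := ‖g.1 p‖ with hm
  have hm0 : 0 < m := norm_pos_iff.2 hgp
  obtain ⟨δ, hδ, hδg⟩ := Metric.continuous_iff.1 g.1.continuous p (m / 20) (by positivity)
  -- The root will jump from `(1 - t) p` to `(1 + t) p`. The last two bounds on `t` serve the
  -- estimate of `t q` away from `p`.
  obtain ⟨t, ht0, ht1, htδ, htg⟩ : ∃ t : ℝ, 0 < t ∧ t < 1 ∧ t ≤ δ / 2 ∧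
      t * (8 * ‖g‖) ≤ m / 4 * δ := by
    have hpos : 0 < m / 4 * δ / (8 * ‖g‖ + 1) := by positivity
    refine ⟨min (1 / 2) (min (δ / 2) (m / 4 * δ / (8 * ‖g‖ + 1))), by positivity,
      (min_le_left _ _).trans_lt (by norm_num), (min_le_right _ _).trans (min_le_left _ _), ?_⟩
    have h1 := (min_le_right (1 / 2) (min (δ / 2) (m / 4 * δ / (8 * ‖g‖ + 1)))).trans
      (min_le_right _ _)
    rw [le_div_iff₀ (by positivity)] at h1
    refine le_trans ?_ h1
    exact mul_le_mul_of_nonneg_left (by linarith) (by positivity)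
  have hwn : ‖((1 - t : ℝ) : ℂ) * p‖ = 1 - t := by
    rw [norm_mul, hp, mul_one, Complex.norm_real, Real.norm_of_nonneg (by linarith)]
  let w : closedBall (0 : ℂ) 1 := ⟨((1 - t : ℝ) : ℂ) * p, by
    rw [mem_closedBall_zero_iff, hwn]; linarith⟩
  have hwdef : (w : ℂ) = ((1 - t : ℝ) : ℂ) * p := rfl
  have hw : ‖(w : ℂ)‖ = 1 - t := hwn
  have hw1 : ‖(w : ℂ)‖ < 1 := by linarith
  have hpw : ‖(p : ℂ) - w‖ = t := by
    rw [hwdef, show (p : ℂ) - ((1 - t : ℝ) : ℂ) * p = (t : ℂ) * p by push_cast; ring, norm_mul, hp,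
      Complex.norm_real, Real.norm_of_nonneg ht0.le, mul_one]
  have hgw : ‖g.1 w - g.1 p‖ < m / 20 := by
    rw [← dist_eq_norm]
    refine hδg w ?_
    rw [Subtype.dist_eq, dist_comm, dist_eq_norm, hpw]
    linarith
  have hgwm : m / 2 < ‖g.1 w‖ := by
    have := norm_sub_norm_le (g.1 p) (g.1 w)
    rw [norm_sub_rev] at this
    linarith
  have hgw0 : g.1 w ≠ 0 := norm_pos_iff.1 (by linarith)
  refine ⟨w, hw1, hgw0, ?_⟩
  obtain ⟨q, hq⟩ := exists_sub_eq_mul g hw1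
  have hone : algebraMap ℂ discAlgebra (g.1 w)⁻¹ * algebraMap ℂ discAlgebra (g.1 w) = 1 := by
    rw [← map_mul, inv_mul_cancel₀ hgw0, map_one]
  have hbez : -(algebraMap ℂ _ (g.1 w)⁻¹) * q * (coord - algebraMap ℂ _ (w : ℂ)) +
      algebraMap ℂ _ (g.1 w)⁻¹ * g = 1 := by
    linear_combination hone - algebraMap ℂ discAlgebra (g.1 w)⁻¹ * hq
  -- On the circle `q = (g z - g w) / (z - w)`. Near `p` the numerator is small and `|z - w| ≥ t`;
  -- away from `p`, `|z - w| ≥ δ / 2` and `t` is small.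
  have hqt : ‖(t : ℂ) • q‖ ≤ m / 8 := by
    refine norm_le_of_forall_sphere (by positivity) fun z hz => ?_
    have hqz : ((z : ℂ) - w) * q.1 z = g.1 z - g.1 w := by
      simpa using congrArg (fun f : discAlgebra => f.1 z) hq
    have hzw : t ≤ ‖(z : ℂ) - w‖ := by
      have := norm_sub_norm_le (z : ℂ) w
      linarith
    have hqz' := congrArg norm hqz
    rw [norm_mul] at hqz'
    have hval : ‖((t : ℂ) • q).1 z‖ = t * ‖q.1 z‖ := by
      change ‖(t : ℂ) * q.1 z‖ = _
      rw [norm_mul, Complex.norm_real, Real.norm_of_nonneg ht0.le]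
    rw [hval]
    by_cases hzp : dist z p < δ
    · have h1 := hδg z hzp
      rw [dist_eq_norm] at h1
      have h2 : ‖g.1 z - g.1 w‖ ≤ m / 8 := by
        have := norm_sub_le_norm_sub_add_norm_sub (g.1 z) (g.1 p) (g.1 w)
        rw [norm_sub_rev (g.1 p)] at this
        linarith
      calc t * ‖q.1 z‖ ≤ ‖(z : ℂ) - w‖ * ‖q.1 z‖ := by gcongr
        _ ≤ m / 8 := hqz'.trans_le h2
    · rw [not_lt, Subtype.dist_eq, dist_eq_norm] at hzp
      have h1 : δ / 2 ≤ ‖(z : ℂ) - w‖ := by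
        have := norm_sub_le_norm_sub_add_norm_sub (z : ℂ) w p
        rw [norm_sub_rev (w : ℂ), hpw] at this
        linarith
      have h2 : ‖g.1 z - g.1 w‖ ≤ 2 * ‖g‖ := by
        have := norm_sub_le (g.1 z) (g.1 w)
        linarith [norm_apply_le g z, norm_apply_le g w]
      have h3 : δ / 2 * ‖q.1 z‖ ≤ 2 * ‖g‖ := by
        refine le_trans ?_ (hqz'.trans_le h2)
        gcongr
      have h4 : δ * (t * ‖q.1 z‖) ≤ δ * (m / 8) := by nlinarith
      exact le_of_mul_le_mul_left h4 hδ
  refine (expReducible_iff_of_norm_lt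
    (f' := coord - algebraMap ℂ _ (((1 + t : ℝ) : ℂ) * p)) hbez ?_).2
    (expReducible_coord_sub_of_one_lt ?_ g)
  · have : ((coord - algebraMap ℂ _ (((1 + t : ℝ) : ℂ) * p)) - (coord - algebraMap ℂ _ (w : ℂ))) *
        (-(algebraMap ℂ _ (g.1 w)⁻¹) * q) = (2 * p * (g.1 w)⁻¹ : ℂ) • ((t : ℂ) • q) := by
      rw [sub_coord_sub, hwdef, smul_smul, Algebra.smul_def, ← map_neg, ← mul_assoc, ← map_mul]
      congr 2
      push_cast
      ring
    rw [this, norm_smul, norm_mul, norm_mul, norm_inv, hp, Complex.norm_ofNat, mul_one]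
    have h5 : ‖g.1 w‖⁻¹ ≤ (m / 2)⁻¹ := inv_anti₀ (by positivity) hgwm.le
    calc 2 * ‖g.1 w‖⁻¹ * ‖(t : ℂ) • q‖ ≤ 2 * (m / 2)⁻¹ * (m / 8) := by gcongr
      _ = 1 / 2 := by field_simp; norm_num
      _ < 1 := by norm_num
  · rw [norm_mul, hp, Complex.norm_real, Real.norm_of_nonneg (by positivity)]
    linarith

/-- The disc is homeomorphic to the plane, where complements of countable sets are connected. -/
theorem isPreconnected_ball_diff_of_countable {Z : Set ℂ} (hZ : Z.Countable) :
    IsPreconnected (ball (0 : ℂ) 1 \ Z) := by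
  have hφ : Continuous fun x : ℂ => (Homeomorph.unitBall x : ℂ) :=
    continuous_subtype_val.comp Homeomorph.unitBall.continuous
  have hinj : Function.Injective fun x : ℂ => (Homeomorph.unitBall x : ℂ) :=
    Subtype.val_injective.comp Homeomorph.unitBall.injective
  have hconn := ((hZ.preimage_of_injOn hinj.injOn).isConnected_compl_of_one_lt_rank
    (by simp)).isPreconnected.image _ hφ.continuousOn
  convert hconn using 1
  ext z
  constructor
  · rintro ⟨hz, hzZ⟩
    exact ⟨Homeomorph.unitBall.symm ⟨z, hz⟩, by simpa using hzZ, by simp⟩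
  · rintro ⟨x, hx, rfl⟩
    exact ⟨(Homeomorph.unitBall x).2, hx⟩

theorem countable_zeros {g : discAlgebra} {w : closedBall (0 : ℂ) 1} (hw : ‖(w : ℂ)‖ < 1)
    (hg : g.1 w ≠ 0) :
    ({z | Function.extend Subtype.val g.1 0 z = 0} ∩ ball (0 : ℂ) 1).Countable := by
  apply (HereditarilyLindelofSpace.isLindelof _).countable_of_isDiscrete
    (isDiscrete_of_codiscreteWithin _)
  have := ((diffContOnCl g).1.analyticOnNhd isOpen_ball).preimage_zero_mem_codiscreteWithin
    (x := (w : ℂ)) (by rwa [extend_apply]) (by simpa using hw)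
    ⟨⟨0, by simp⟩, (convex_ball _ _).isPreconnected⟩
  exact this

theorem expReducible_coord_sub_of_norm_lt_one {g : discAlgebra} {w : closedBall (0 : ℂ) 1}
    (hw : ‖(w : ℂ)‖ < 1) (hg : g.1 w ≠ 0) : ExpReducible (coord - algebraMap ℂ _ (w : ℂ)) g := by
  obtain ⟨w', hw', hgw', hred⟩ := exists_expReducible_coord_sub (g := g) (by
    rintro rfl
    exact hg rfl)
  have hconn := isPreconnected_ball_diff_of_countable (countable_zeros hw hg)
  have hmem : ∀ z : closedBall (0 : ℂ) 1, ‖(z : ℂ)‖ < 1 → g.1 z ≠ 0 →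
      (z : ℂ) ∈ ball (0 : ℂ) 1 \
        ({z | Function.extend Subtype.val g.1 0 z = 0} ∩ ball (0 : ℂ) 1) := by
    refine fun z hz hgz => ⟨by simpa using hz, fun h => hgz ?_⟩
    rw [← extend_apply]
    exact h.1
  refine (hconn.induction₂ (fun x y : ℂ => ExpReducible (coord - algebraMap ℂ _ x) g ↔
    ExpReducible (coord - algebraMap ℂ _ y) g) ?_ (fun _ _ _ _ _ _ h h' => h.trans h')
    (fun _ _ _ _ h => h.symm) (hmem w hw hg) (hmem w' hw' hgw')).2 hred
  -- Local constancy in the root: a Bézout identity at `x` allows every perturbation smaller than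
  -- `(‖u‖ + 1)⁻¹`.
  rintro x ⟨hx, hxZ⟩
  refine Filter.Eventually.filter_mono nhdsWithin_le_nhds ?_
  obtain ⟨u, v, huv⟩ := exists_bezout_coord_sub (g := g) (w := ⟨x, ball_subset_closedBall hx⟩)
    (by simpa using hx) (by
      rw [← extend_apply]
      exact fun h => hxZ ⟨h, hx⟩)
  filter_upwards [ball_mem_nhds x (show 0 < (‖u‖ + 1)⁻¹ by positivity)] with y hy
  refine expReducible_iff_of_norm_lt huv ?_
  rw [sub_coord_sub, ← Algebra.smul_def, norm_smul, ← dist_eq_norm, dist_comm]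
  have hy' : dist y x * (‖u‖ + 1) < 1 := by
    rwa [mem_ball, ← one_div, lt_div_iff₀ (by positivity)] at hy
  nlinarith [dist_nonneg (x := y) (y := x)]

theorem expReducible_coord_sub {w : ℂ} {g u v : discAlgebra}
    (huv : u * (coord - algebraMap ℂ _ w) + v * g = 1) :
    ExpReducible (coord - algebraMap ℂ _ w) g := by
  rcases lt_trichotomy ‖w‖ 1 with hw | hw | hw
  · refine expReducible_coord_sub_of_norm_lt_one (w := ⟨w, by simpa using hw.le⟩) hw fun hg => ?_
    have := congrArg (evalHom ⟨w, by simpa using hw.le⟩) huv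
    simp [evalHom_apply, hg] at this
  · exact expReducible_coord_sub_of_norm_eq_one hw huv
  · exact expReducible_coord_sub_of_one_lt hw g

theorem expReducible_prod_coord_sub {g : discAlgebra} (s : Multiset ℂ) {u v : discAlgebra}
    (huv : u * (s.map fun w => coord - algebraMap ℂ discAlgebra w).prod + v * g = 1) :
    ExpReducible (s.map fun w => coord - algebraMap ℂ discAlgebra w).prod g := by
  induction s using Multiset.induction_on generalizing u v with
  | empty => exact ⟨0, 0, by simp⟩
  | cons w s ih =>
    rw [Multiset.map_cons, Multiset.prod_cons] at huv ⊢
    refine ExpReducible.mul (expReducible_coord_sub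
      (u := u * (s.map fun w => coord - algebraMap ℂ discAlgebra w).prod) (v := v) ?_)
      (ih (u := u * (coord - algebraMap ℂ discAlgebra w)) (v := v) ?_)
    · rw [← huv]
      ring
    · rw [← huv]
      ring

theorem expReducible_aeval_coord (p : Polynomial ℂ) {g u v : discAlgebra}
    (huv : u * Polynomial.aeval coord p + v * g = 1) :
    ExpReducible (Polynomial.aeval coord p) g := by
  rcases eq_or_ne p 0 with rfl | hp
  -- Here `v * g = 1 = exp 0`.
  · exact ⟨0, v, by simpa using huv⟩
  have hfac : Polynomial.aeval coord p = algebraMap ℂ discAlgebra p.leadingCoeff *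
      (p.roots.map fun w => coord - algebraMap ℂ discAlgebra w).prod := by
    conv_lhs => rw [(IsAlgClosed.splits p).eq_prod_roots]
    rw [map_mul, Polynomial.aeval_C, map_multiset_prod, Multiset.map_map]
    simp
  rw [hfac] at huv ⊢
  obtain ⟨h, hh⟩ := exists_exp_eq_algebraMap (Polynomial.leadingCoeff_ne_zero.2 hp)
  refine ExpReducible.mul (hh ▸ expReducible_exp h g) (expReducible_prod_coord_sub p.roots
    (u := u * algebraMap ℂ discAlgebra p.leadingCoeff) (v := v) ?_)
  rw [← huv]
  ring

/-- The disc algebra has stable rank one; moreover the unit can be chosen to be an exponential. -/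
theorem expReducible_of_bezout {f g u v : discAlgebra} (huv : u * f + v * g = 1) :
    ExpReducible f g := by
  obtain ⟨p, hp⟩ := exists_polynomial_norm_sub_lt f (show 0 < (‖u‖ + 1)⁻¹ by positivity)
  have hlt : ‖(Polynomial.aeval coord p - f) * u‖ < 1 := by
    refine (norm_mul_le _ _).trans_lt ?_
    rw [← one_div, lt_div_iff₀ (by positivity)] at hp
    nlinarith [norm_nonneg (Polynomial.aeval coord p - f)]
  obtain ⟨u', v', huv'⟩ := exists_bezout_of_norm_lt huv hlt
  exact (expReducible_iff_of_norm_lt huv hlt).2 (expReducible_aeval_coord p huv')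

end discAlgebra

/-! ### Triangular matrices as exponentials -/

section TriangularExponentials

variable {𝔸 : Type*} [NormedCommRing 𝔸] [NormedAlgebra ℚ 𝔸] [CompleteSpace 𝔸]

/-- A lower triangular matrix with diagonal `exp g, exp (-g)` is the exponential of a matrix of
trace zero if `exp g - exp (-g)` is invertible. -/
theorem exists_exp_eq_lower_triangular {g : 𝔸}
    (h : IsUnit (NormedSpace.exp g - NormedSpace.exp (-g))) (c : 𝔸) :
    ∃ X : Matrix (Fin 2) (Fin 2) 𝔸, X.trace = 0 ∧
      NormedSpace.exp X = !![NormedSpace.exp g, 0; c, NormedSpace.exp (-g)] := by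
  obtain ⟨d, hd⟩ := h.exists_right_inv
  let P : (Matrix (Fin 2) (Fin 2) 𝔸)ˣ :=
    -- Conjugating the diagonal matrix by a unipotent with entry `s` creates the corner `s * (exp g
    -- - exp (-g))`; hence `s = c * d`.
    ⟨!![1, 0; c * d, 1], !![1, 0; -(c * d), 1], by simp [Matrix.one_fin_two],
      by simp [Matrix.one_fin_two]⟩
  refine ⟨P * Matrix.diagonal ![g, -g] * (P⁻¹ : (Matrix (Fin 2) (Fin 2) 𝔸)ˣ), ?_, ?_⟩
  · rw [Matrix.trace_units_conj]
    simp
  · rw [Matrix.exp_units_conj, Matrix.exp_diagonal]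
    have hdiag : Matrix.diagonal (NormedSpace.exp ![g, -g]) =
        !![NormedSpace.exp g, 0; 0, NormedSpace.exp (-g)] := by
      ext i j
      fin_cases i <;> fin_cases j <;> simp [Pi.coe_exp]
    rw [hdiag]
    change !![1, 0; c * d, 1] * _ * !![1, 0; -(c * d), 1] = _
    rw [Matrix.mul_fin_two, Matrix.mul_fin_two]
    ext i j
    fin_cases i <;> fin_cases j <;> simp
    linear_combination c * hd

/-- An upper triangular matrix with diagonal `exp g, exp (-g)` is the exponential of a matrix of
trace zero if `exp g - exp (-g)` is invertible. -/
theorem exists_exp_eq_upper_triangular {g : 𝔸}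
    (h : IsUnit (NormedSpace.exp g - NormedSpace.exp (-g))) (b : 𝔸) :
    ∃ X : Matrix (Fin 2) (Fin 2) 𝔸, X.trace = 0 ∧
      NormedSpace.exp X = !![NormedSpace.exp g, b; 0, NormedSpace.exp (-g)] := by
  obtain ⟨X, hX, hexp⟩ := exists_exp_eq_lower_triangular h b
  refine ⟨X.transpose, by rwa [Matrix.trace_transpose], ?_⟩
  rw [Matrix.exp_transpose, hexp]
  ext i j
  fin_cases i <;> fin_cases j <;> rfl

theorem exists_eq_exp_mul_exp_of_isUnit {M : Matrix (Fin 2) (Fin 2) 𝔸} (hM : M.det = 1)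
    {α g k : 𝔸} (h : M 0 0 + α * M 1 0 = NormedSpace.exp g * NormedSpace.exp k)
    (hg : IsUnit (NormedSpace.exp g - NormedSpace.exp (-g)))
    (hk : IsUnit (NormedSpace.exp k - NormedSpace.exp (-k))) :
    ∃ X Y : Matrix (Fin 2) (Fin 2) 𝔸, X.trace = 0 ∧ Y.trace = 0 ∧
      M = NormedSpace.exp X * NormedSpace.exp Y := by
  let E : (Matrix (Fin 2) (Fin 2) 𝔸)ˣ :=
    ⟨!![1, -α; 0, 1], !![1, α; 0, 1], by simp [Matrix.one_fin_two],
      by simp [Matrix.one_fin_two]⟩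
  have hneg : ∀ x : 𝔸, NormedSpace.exp x * NormedSpace.exp (-x) = 1 := fun x => by
    rw [← NormedSpace.exp_add, add_neg_cancel, NormedSpace.exp_zero]
  -- The corners of both factors are forced by those of `E⁻¹ * M * E`; the lower right entry then
  -- agrees because `det M = 1`.
  obtain ⟨X, hX, hXexp⟩ := exists_exp_eq_lower_triangular hg (M 1 0 * NormedSpace.exp (-k))
  obtain ⟨Y, hY, hYexp⟩ := exists_exp_eq_upper_triangular hk
    ((M 0 1 + α * M 1 1 - α * (M 0 0 + α * M 1 0)) * NormedSpace.exp (-g))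
  refine ⟨E * X * (E⁻¹ : (Matrix (Fin 2) (Fin 2) 𝔸)ˣ),
    E * Y * (E⁻¹ : (Matrix (Fin 2) (Fin 2) 𝔸)ˣ), by rwa [Matrix.trace_units_conj],
    by rwa [Matrix.trace_units_conj], ?_⟩
  rw [Matrix.exp_units_conj, Matrix.exp_units_conj]
  have hprod : NormedSpace.exp X * NormedSpace.exp Y =
      (E⁻¹ : (Matrix (Fin 2) (Fin 2) 𝔸)ˣ) * M * E := by
    change _ = !![1, α; 0, 1] * M * !![1, -α; 0, 1]
    rw [Matrix.det_fin_two] at hM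
    have hg' := hneg g
    have hk' := hneg k
    rw [hXexp, hYexp, Matrix.eta_fin_two M]
    generalize M 0 0 = a at *
    generalize M 0 1 = b at *
    generalize M 1 0 = c at *
    generalize M 1 1 = d at *
    rw [Matrix.mul_fin_two, Matrix.mul_fin_two, Matrix.mul_fin_two]
    generalize NormedSpace.exp g = x at *
    generalize NormedSpace.exp (-g) = x' at *
    generalize NormedSpace.exp k = y at *
    generalize NormedSpace.exp (-k) = y' at *
    ext i j
    fin_cases i <;> fin_cases j <;> simp
    · linear_combination -h
    · linear_combination (b + α * d - α * (a + α * c)) * hg'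
    · linear_combination c * hk'
    · linear_combination -(x' * y') * hM + x' * y' * (d - c * α) * h +
        (d - c * α) * (y * y' * hg' + hk')
  calc M = E * ((E⁻¹ : (Matrix (Fin 2) (Fin 2) 𝔸)ˣ) * M * E) *
        (E⁻¹ : (Matrix (Fin 2) (Fin 2) 𝔸)ˣ) := by
        simp only [← mul_assoc, Units.mul_inv, one_mul, Units.mul_inv_cancel_right]
    _ = _ := by
        rw [← hprod]
        simp only [← mul_assoc, Units.inv_mul_cancel_right]

end TriangularExponentials

/-! ### The factorization -/

namespace discAlgebra

theorem isUnit_exp_sub_exp_neg {f : discAlgebra} (h : ∀ z, (f.1 z).re ≠ 0) :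
    IsUnit (NormedSpace.exp f - NormedSpace.exp (-f)) := by
  refine isUnit_of_forall_ne_zero fun z hz => h z ?_
  have h1 : Complex.exp (f.1 z) = Complex.exp (-f.1 z) := by
    rw [← sub_eq_zero]
    change (NormedSpace.exp f).1 z - (NormedSpace.exp (-f)).1 z = 0 at hz
    rwa [exp_apply, exp_apply] at hz
  have h2 := congrArg norm h1
  rw [Complex.norm_exp, Complex.norm_exp, Real.exp_eq_exp, Complex.neg_re] at h2
  linarith

end discAlgebra

theorem theorem2 (M : Matrix.SpecialLinearGroup (Fin 2) discAlgebra) :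
    ∃ X Y : Matrix (Fin 2) (Fin 2) discAlgebra,
      X.trace = 0 ∧ Y.trace = 0 ∧
        (M : Matrix (Fin 2) (Fin 2) discAlgebra) = NormedSpace.exp X * NormedSpace.exp Y := by
  have hdet := M.det_coe
  have hdet' := hdet
  rw [Matrix.det_fin_two] at hdet'
  obtain ⟨h, α, hα⟩ := discAlgebra.expReducible_of_bezout (f := M.1 0 0) (g := M.1 1 0)
    (u := M.1 1 1) (v := -M.1 0 1) (by linear_combination hdet')
  -- This constant exceeds `Re h` everywhere, so `Re k > 0` and `Re (h - k) < 0`.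
  set k : discAlgebra := algebraMap ℂ discAlgebra ((‖h‖ + 1 : ℝ) : ℂ) with hk
  have hre (z) : (h.1 z).re ≤ ‖h‖ :=
    (Complex.re_le_norm _).trans (discAlgebra.norm_apply_le h z)
  refine exists_eq_exp_mul_exp_of_isUnit hdet (α := α) (g := h - k) (k := k) ?_
    (discAlgebra.isUnit_exp_sub_exp_neg fun z => ?_)
    (discAlgebra.isUnit_exp_sub_exp_neg fun z => ?_)
  · rw [← NormedSpace.exp_add, sub_add_cancel]
    exact hα
  · change (h.1 z - ((‖h‖ + 1 : ℝ) : ℂ)).re ≠ 0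
    rw [Complex.sub_re, Complex.ofReal_re]
    linarith [hre z]
  · change (((‖h‖ + 1 : ℝ) : ℂ)).re ≠ 0
    rw [Complex.ofReal_re]
    positivity
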